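/- **Setting.** Let $f=\frac1n\sum_{i=1}^n f_i$ with $n\ge 1$, where each $f_i:\mathbb{R}^d\to\mathbb{R}$ is convex and differentiable with $\|\nabla f_i(x)-\nabla f_i(y)\|\le L\|x-y\|$ for all $x,y\in\mathbb{R}^d$. Let $x^*$ be a minimizer of $f$, let $x_0\ne x^*$ and $\epsilon>0$. For $\mu>0$ put $$\tilde f_i(x)=f_i(x)+\tfrac{\mu}{2}\|x-x_0\|^2,\qquad \tilde f=\tfrac1n\sum_{i=1}^n\tilde f_i=f+\tfrac{\mu}{2}\|\cdot-x_0\|^2,\qquad \tilde\kappa=\frac{L+\mu}{\mu}.$$ **Algorithm.** BB-SARAH applied to $\tilde f$ with parameters $\eta^{(1)},\lambda,m,S$ sets $\tilde x^0=x_0$ and does the following for $s=1,\dots,S$. For $s>1$ it takes the Barzilai–Borwein step size $$\eta^{(s)}=\frac1\lambda\,\frac{\|\tilde x^{s-1}-\tilde x^{s-2}\|^2}{\langle \tilde x^{s-1}-\tilde x^{s-2},\,\nabla\tilde f(\tilde x^{s-1})-\nabla\tilde f(\tilde x^{s-2})\rangle}$$ (keeping $\eta^{(s)}=\eta^{(s-1)}$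 if $\tilde x^{s-1}=\tilde x^{s-2}$). It puts $x_0^s=\tilde x^{s-1}$, $v_0^s=\nabla\tilde f(x_0^s)$ and $x_1^s=x_0^s-\eta^{(s)}v_0^s$. For $k=1,\dots,m-1$ it draws $i_k\in\{1,\dots,n\}$ uniformly and sets $v_k^s=\nabla\tilde f_{i_k}(x_k^s)-\nabla\tilde f_{i_k}(x_{k-1}^s)+v_{k-1}^s$ and $x_{k+1}^s=x_k^s-\eta^{(s)}v_k^s$. It then draws $\tilde x^s$ uniformly from $x_0^s,\dots,x_m^s$. All draws are independent. The output is $x=\tilde x^S$. The complexity is the number of incremental first-order oracle (IFO) calls, that is, of evaluations of a gradient $\nabla f_i(x)$ of one component at one point (one evaluation of $\nabla\tilde f_i$ takes one call). **Statement.** Write $\ell=\max\{1,\ln(\|\nabla f(x_0)\|^2/\epsilon)\}$, and choose $$\mu=c\,\frac{\sqrt\epsilon}{\|x_0-x^*\|},\qquad \lambda=a\tilde\kappa,\qquad m=\lceil b\tilde\kappa^2\rceil,\qquad S=\lceil \sigma\ell\rceil,\qquad \frac{1}{\lambda(L+\mu)}\le\eta^{(1)}\le\frac1{\lambda\mu}.$$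 There are absolute constants $c_0,a_0>0$ such that for all $0<c\le c_0$ and $a\ge a_0$, for all $b$ larger than a constant depending only on $a,c$, and for all $\sigma$ larger than a constant depending only on $a,b,c$, there is a constant $C$ depending only on $a,b,c,\sigma$ (and not on $d,n,L,f,x_0,x^*,\epsilon$) such that BB-SARAH on $\tilde f$ with these parameters returns $x$ with $\mathbb{E}\|\nabla f(x)\|^2\le\epsilon$ and makes at most $$C\Big(n+\frac{L^2\|x_0-x^*\|^2}{\epsilon}\Big)\max\Big\{1,\ln\frac{\|\nabla f(x_0)\|^2}{\epsilon}\Big\}$$ IFO calls. -/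

import Mathlib

noncomputable section

/-- The space `ℝ^d` with the Euclidean norm and inner product. -/
abbrev Vec (d : ℕ) : Type := EuclideanSpace ℝ (Fin d)

/-- The finite sum objective `f = (1/n) ∑ᵢ fᵢ`. -/
def avg {d n : ℕ} (f : Fin n → Vec d → ℝ) (x : Vec d) : ℝ :=
  (1 / (n : ℝ)) * ∑ i, f i x

/-- The components `f̃ᵢ(x) = fᵢ(x) + (μ/2) ‖x - x₀‖²` of the regularized surrogate
`f̃ = (1/n) ∑ᵢ f̃ᵢ = f + (μ/2) ‖· - x₀‖²`. One gradient of `f̃ᵢ` takes one gradient of `fᵢ`. -/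
def regularize {d n : ℕ} (f : Fin n → Vec d → ℝ) (μ : ℝ) (x₀ : Vec d) :
    Fin n → Vec d → ℝ :=
  fun i x => f i x + μ / 2 * ‖x - x₀‖ ^ 2

/-- Randomized algorithms with access to the `n` component functions only through an
incremental first-order oracle (IFO). Real arithmetic is free; a program may
* stop and return a value,
* call the IFO with an index `i` and a point `x`, and go on depending on the answer,
* draw a fresh random number from a finite law `p`, and go on depending on the outcome. -/
inductive Prog (d n : ℕ) (α : Type) : Type
  | ret (a : α) : Prog d n α
  | call (i : Fin n) (x : Vec d) (next : Vec d → Prog d n α) : Prog d n α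
  | rand (N : ℕ) (p : PMF (Fin N)) (next : Fin N → Prog d n α) : Prog d n α

namespace Prog

variable {d n : ℕ}

/-- Sequential composition. -/
def bind {α β : Type} : Prog d n α → (α → Prog d n β) → Prog d n β
  | ret a, F => F a
  | call i x next, F => call i x (fun g => (next g).bind F)
  | rand N p next, F => rand N p (fun j => (next j).bind F)

instance : Monad (Prog d n) where
  pure := ret
  bind := bind

/-- A single IFO call. -/
def ifo (i : Fin n) (x : Vec d) : Prog d n (Vec d) := call i x ret

/-- A single random draw. -/
def draw {N : ℕ} (p : PMF (Fin N)) : Prog d n (Fin N) := rand N p ret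

/-- `P.expect F φ` is `𝔼[φ(a)]`, where `a` is the random value returned by `P` when the IFO
answers with the gradients of the component functions `F i`. -/
def expect {α : Type} (F : Fin n → Vec d → ℝ) (φ : α → ℝ) : Prog d n α → ℝ
  | ret a => φ a
  | call i x next => expect F φ (next (gradient (F i) x))
  | rand _ p next => ∑ j, (p j).toReal * expect F φ (next j)

/-- The number of IFO calls that `P` makes on the component functions `F i`, in the worst case
over the random draws. -/
def ifoCalls {α : Type} (F : Fin n → Vec d → ℝ) : Prog d n α → ℕ
  | ret _ => 0
  | call i x next => ifoCalls F (next (gradient (F i) x)) + 1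
  | rand _ _ next => Finset.univ.sup fun j => ifoCalls F (next j)

end Prog

/-- The sum of the gradients at `x` of the components in a list, one IFO call for each. -/
def sumGrad {d n : ℕ} (x : Vec d) : List (Fin n) → Prog d n (Vec d)
  | [] => pure 0
  | i :: is => do
    let g ← Prog.ifo i x
    let r ← sumGrad x is
    pure (g + r)

/-- The full gradient at `x` of the average of the components. -/
def fullGrad {d n : ℕ} (x : Vec d) : Prog d n (Vec d) := do
  let g ← sumGrad x (List.finRange n)
  pure ((1 / (n : ℝ)) • g)

/-- `r` iterations of the inner loop of SARAH with step size `η`, from the last two iterates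
`xPrev = x_{k-1}`, `x = x_k` and the last gradient estimate `v = v_{k-1}`. It returns the list
`[x_k, x_{k+1}, …, x_{k+r}]`. -/
def innerLoop {d n : ℕ} [NeZero n] (η : ℝ) :
    ℕ → Vec d → Vec d → Vec d → Prog d n (List (Vec d))
  | 0, _, x, _ => pure [x]
  | r + 1, xPrev, x, v => do
    let i ← Prog.draw (PMF.uniformOfFintype (Fin n))
    let g ← Prog.ifo i x
    let gPrev ← Prog.ifo i xPrev
    let vNew := g - gPrev + v
    let xs ← innerLoop η r x (x - η • vNew) vNew
    pure (x :: xs)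

open Classical in
/-- The Barzilai-Borwein step size with parameter `lam` at the snapshot `x` with full gradient `g`.
`last` holds the preceding snapshot and its full gradient; there is none in the first outer loop,
where the prescribed initial step size `η` is used. If the two snapshots coincide, then the quotient
is the undefined expression `0 / 0` and the preceding step size `η` is kept. -/
def bbStep {d : ℕ} (lam : ℝ) (last : Option (Vec d × Vec d)) (η : ℝ) (x g : Vec d) : ℝ :=
  match last with
  | none => η
  | some (xPrev, gPrev) =>
    if x = xPrev then η
    else (1 / lam) * (‖x - xPrev‖ ^ 2 / inner ℝ (x - xPrev) (g - gPrev))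

/-- The outer loops `s, s + 1, …` of BB-SARAH, `r` of them, from the snapshot `x`. Within a loop the
iterates `x_0, …, x_m` are computed and the next snapshot is `x_k` with `k ∈ {0, …, m}` drawn from
`p s` (here `m ≥ 1`, so that the default value of `getD` is never used). -/
def outerLoop {d n : ℕ} [NeZero n] (lam : ℝ) (m : ℕ) (p : ℕ → PMF (Fin (m + 1))) :
    ℕ → ℕ → Option (Vec d × Vec d) → ℝ → Vec d → Prog d n (Vec d)
  | 0, _, _, _, x => pure x
  | r + 1, s, last, η, x => do
    let v ← fullGrad x
    let ηNew := bbStep lam last η x v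
    let xs ← innerLoop ηNew (m - 1) x (x - ηNew • v) v
    let k ← Prog.draw (p s)
    outerLoop lam m p r (s + 1) (some (x, v)) ηNew ((x :: xs).getD k x)

/-- BB-SARAH from `x₀` with initial step size `η`, Barzilai-Borwein parameter `lam`, inner loop
length `m`, `S` outer loops, and snapshot laws `p 1, …, p S`. -/
def bbSarah {d n : ℕ} [NeZero n] (x₀ : Vec d) (η lam : ℝ) (m S : ℕ)
    (p : ℕ → PMF (Fin (m + 1))) : Prog d n (Vec d) :=
  outerLoop lam m p S 1 none η x₀

end

/-! Write F for the regularized average and K = L + μ; F is μ-strongly convex with convex K-smooth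
components. The core is a potential for SARAH: with q = ηK/(2 - ηK), the quantity ‖∇F(x_{k-1}) - v‖²
+ q‖v‖² does not increase in expectation along the inner loop. Indeed, the variance added by one
draw is at most the mean of ‖D_i‖², D_i being a component's gradient difference, and cocoercivity
along the step -ηv gives ‖D_i‖² + q‖D_i + v‖² ≤ q‖v‖² (`sarah_norm_sq_le`,
`average_sarah_potential_le`).

An epoch starts with the exact gradient, so the potential never exceeds q‖∇F(x)‖² in expectation.
Summing the inexact descent steps and using F(x) - F(y) ≤ ‖∇F(x)‖²/(2μ), the mean of ‖∇F‖² over the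
m + 1 iterates is at most (1/(μη(m+1)) + q)‖∇F(x)‖². The curvature quotient lies in [μ, K], so every
Barzilai–Borwein step lies in [1/(λK), 1/(λμ)]. Then λ ~ κ makes q ≤ 1/3 and m ~ κ² makes the other
term at most 1/6: each epoch halves the expected squared gradient norm (`expect_epoch_le`).

Finally ‖∇f(x)‖² ≤ 8‖∇F(x)‖² + 8(μ‖x₀ - x*‖)², and the choice of μ makes the last term O(ε).
Logarithmically many epochs of n + O(κ²) calls suffice, where κ² = O(1 + L²‖x₀ - x*‖²/ε). -/

noncomputable section ConvexAnalysis

/-! ### Smooth convex functions on a Hilbert space -/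

variable {E : Type*} [NormedAddCommGroup E] [InnerProductSpace ℝ E] [CompleteSpace E]

/-- `g` is convex with gradient field `G`, and `G` is `K`-Lipschitz. -/
structure SmoothConvex (g : E → ℝ) (G : E → E) (K : ℝ) : Prop where
  hasGradientAt : ∀ x, HasGradientAt g (G x) x
  lipschitz : ∀ x y, ‖G x - G y‖ ≤ K * ‖x - y‖
  convexOn : ConvexOn ℝ Set.univ g

theorem HasGradientAt.hasDerivAt_line {g : E → ℝ} {G x u : E} {t : ℝ}
    (h : HasGradientAt g G (x + t • u)) :
    HasDerivAt (fun s : ℝ => g (x + s • u)) (inner ℝ G u) t := by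
  have h1 : HasDerivAt (fun s : ℝ => x + s • u) u t := by
    simpa using ((hasDerivAt_id t).smul_const u).const_add x
  have h2 := h.hasFDerivAt.comp_hasDerivAt t h1
  simp only [InnerProductSpace.toDual_apply_apply] at h2
  exact h2

theorem ConvexOn.add_inner_le {g : E → ℝ} {G x : E} (hc : ConvexOn ℝ Set.univ g)
    (h : HasGradientAt g G x) (y : E) : g x + inner ℝ G (y - x) ≤ g y := by
  have hc' : ConvexOn ℝ Set.univ (fun s : ℝ => g (x + s • (y - x))) := by
    refine ⟨convex_univ, fun s _ t _ a b ha hb hab => ?_⟩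
    have := hc.2 (Set.mem_univ (x + s • (y - x))) (Set.mem_univ (x + t • (y - x))) ha hb hab
    convert this using 2
    have hx : x = (a + b) • x := by rw [hab, one_smul]
    simp only [smul_eq_mul]
    nth_rewrite 1 [hx]
    module
  have h0 : HasGradientAt g G (x + (0 : ℝ) • (y - x)) := by simpa using h
  have := hc'.le_slope_of_hasDerivAt (Set.mem_univ 0) (Set.mem_univ 1) one_pos
    h0.hasDerivAt_line
  simp [slope_def_field] at this
  linarith

namespace SmoothConvex

variable {g : E → ℝ} {G : E → E} {K : ℝ}

theorem add_inner_le (h : SmoothConvex g G K) (x y : E) : g x + inner ℝ (G x) (y - x) ≤ g y :=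
  h.convexOn.add_inner_le (h.hasGradientAt x) y

theorem descent (h : SmoothConvex g G K) (x y : E) :
    g y ≤ g x + inner ℝ (G x) (y - x) + K / 2 * ‖y - x‖ ^ 2 := by
  set u := y - x with hu
  have hd : ∀ t : ℝ, HasDerivAt (fun s : ℝ => g (x + s • u)) (inner ℝ (G (x + t • u)) u) t :=
    fun t => (h.hasGradientAt _).hasDerivAt_line
  have hB : ∀ t : ℝ, HasDerivAt
      (fun s : ℝ => g x + s * inner ℝ (G x) u + K / 2 * ‖u‖ ^ 2 * s ^ 2)
      (inner ℝ (G x) u + K * ‖u‖ ^ 2 * t) t := by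
    intro t
    have h1 := ((hasDerivAt_id t).mul_const (inner ℝ (G x) u)).const_add (g x)
    have h2 := ((hasDerivAt_id t).pow 2).const_mul (K / 2 * ‖u‖ ^ 2)
    refine (h1.add h2).congr_deriv ?_
    simp
    ring
  -- Both sides agree at t = 0; the Lipschitz bound compares their derivatives on the segment.
  have key := image_le_of_deriv_right_le_deriv_boundary (a := 0) (b := 1)
    (fun t _ => (hd t).continuousAt.continuousWithinAt) (fun t _ => (hd t).hasDerivWithinAt)
    (B := fun s : ℝ => g x + s * inner ℝ (G x) u + K / 2 * ‖u‖ ^ 2 * s ^ 2) (by simp)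
    (fun t _ => (hB t).continuousAt.continuousWithinAt) (fun t _ => (hB t).hasDerivWithinAt)
    (fun t ht => ?_) (Set.right_mem_Icc.2 zero_le_one)
  · simpa [hu] using key
  · have h1 : inner ℝ (G (x + t • u) - G x) u ≤ ‖G (x + t • u) - G x‖ * ‖u‖ :=
      real_inner_le_norm _ _
    have h2 := h.lipschitz (x + t • u) x
    rw [add_sub_cancel_left, norm_smul, Real.norm_of_nonneg ht.1] at h2
    rw [inner_sub_left] at h1
    nlinarith [mul_le_mul_of_nonneg_right h2 (norm_nonneg u)]

/-- The tangent at x bounds g from below, and the descent lemma at y bounds it from above; compare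
the two at the point y - D/K, where D = G y - G x. -/
theorem add_inner_add_le (h : SmoothConvex g G K) (hK : 0 < K) (x y : E) :
    g x + inner ℝ (G x) (y - x) + 1 / (2 * K) * ‖G y - G x‖ ^ 2 ≤ g y := by
  set D := G y - G x with hD
  have h1 := h.add_inner_le x (y - K⁻¹ • D)
  have h2 := h.descent y (y - K⁻¹ • D)
  have e1 : y - K⁻¹ • D - x = (y - x) - K⁻¹ • D := by abel
  have e2 : y - K⁻¹ • D - y = -(K⁻¹ • D) := by abel
  have e3 : inner ℝ (G y) D = inner ℝ (G x) D + ‖D‖ ^ 2 := by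
    rw [← real_inner_self_eq_norm_sq, ← inner_add_left, hD]
    simp
  rw [e1, inner_sub_right, inner_smul_right] at h1
  rw [e2, inner_neg_right, inner_smul_right, norm_neg, norm_smul, mul_pow, e3, Real.norm_eq_abs,
    sq_abs] at h2
  have e4 : K / 2 * (K⁻¹ ^ 2 * ‖D‖ ^ 2) = K⁻¹ * ‖D‖ ^ 2 - 1 / (2 * K) * ‖D‖ ^ 2 := by
    field_simp
    ring
  rw [e4] at h2
  linarith

theorem cocoercive (h : SmoothConvex g G K) (hK : 0 < K) (x y : E) :
    ‖G x - G y‖ ^ 2 ≤ K * inner ℝ (x - y) (G x - G y) := by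
  have h1 := h.add_inner_add_le hK x y
  have h2 := h.add_inner_add_le hK y x
  have h3 : 1 / K * ‖G x - G y‖ ^ 2 ≤ inner ℝ (x - y) (G x - G y) := by
    rw [real_inner_comm]
    have e : 1 / K * ‖G x - G y‖ ^ 2 =
        1 / (2 * K) * ‖G x - G y‖ ^ 2 + 1 / (2 * K) * ‖G x - G y‖ ^ 2 := by
      field_simp
      ring
    rw [norm_sub_rev (G y)] at h1
    rw [e]
    simp only [inner_sub_left, inner_sub_right] at *
    linarith
  calc ‖G x - G y‖ ^ 2 = K * (1 / K * ‖G x - G y‖ ^ 2) := by field_simp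
    _ ≤ _ := by gcongr

/-- One step of size `η ≤ 1 / K` along an estimate `v` of the gradient. -/
theorem inexact_step (h : SmoothConvex g G K) {η : ℝ} (hη : 0 ≤ η) (hηK : η * K ≤ 1) (x v : E) :
    g (x - η • v) ≤ g x - η / 2 * ‖G x‖ ^ 2 + η / 2 * ‖G x - v‖ ^ 2 := by
  have h1 := h.descent x (x - η • v)
  have e : x - η • v - x = -(η • v) := by abel
  rw [e, inner_neg_right, inner_smul_right, norm_neg, norm_smul, mul_pow, Real.norm_eq_abs,
    sq_abs] at h1
  have e2 : ‖G x - v‖ ^ 2 = ‖G x‖ ^ 2 - 2 * inner ℝ (G x) v + ‖v‖ ^ 2 := norm_sub_sq_real _ _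
  -- Since ηK ≤ 1, the quadratic term is at most η/2 ‖v‖², and -⟨G x, v⟩ + ‖v‖²/2 is half of ‖G x -
  -- v‖² - ‖G x‖².
  have h3 : η * K * (η * ‖v‖ ^ 2) ≤ 1 * (η * ‖v‖ ^ 2) := by gcongr
  rw [e2]
  linarith

theorem norm_sq_le (h : SmoothConvex g G K) (hK : 0 < K) {B : ℝ} (hB : ∀ x, B ≤ g x) (x : E) :
    ‖G x‖ ^ 2 ≤ 2 * K * (g x - B) := by
  have h1 := h.inexact_step (inv_nonneg.2 hK.le) (by field_simp; exact le_rfl) x (G x)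
  have h2 := hB (x - K⁻¹ • G x)
  simp only [sub_self, norm_zero] at h1
  have h3 : K⁻¹ / 2 * ‖G x‖ ^ 2 ≤ g x - B := by linarith
  calc ‖G x‖ ^ 2 = 2 * K * (K⁻¹ / 2 * ‖G x‖ ^ 2) := by field_simp
    _ ≤ _ := by gcongr

theorem regularize (h : SmoothConvex g G K) {μ : ℝ} (hμ : 0 ≤ μ) (x₀ : E) :
    SmoothConvex (fun x => g x + μ / 2 * ‖x - x₀‖ ^ 2) (fun x => G x + μ • (x - x₀)) (K + μ) where
  hasGradientAt x := by
    have h1 := (h.hasGradientAt x).hasFDerivAt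
    have h2 : HasFDerivAt (fun x : E => x - x₀) (ContinuousLinearMap.id ℝ E) x :=
      (hasFDerivAt_id x).sub_const x₀
    have h3 := h1.add (h2.norm_sq.const_mul (μ / 2))
    refine hasGradientAt_iff_hasFDerivAt.2 (h3.congr_fderiv ?_)
    ext u
    simp
    ring
  lipschitz x y := by
    have e : G x + μ • (x - x₀) - (G y + μ • (y - x₀)) = (G x - G y) + μ • (x - y) := by module
    rw [e, add_mul]
    refine (norm_add_le _ _).trans (add_le_add (h.lipschitz x y) ?_)
    rw [norm_smul, Real.norm_of_nonneg hμ]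
  convexOn := by
    refine h.convexOn.add (ConvexOn.smul (c := μ / 2) (by positivity) ?_)
    have h1 : ConvexOn ℝ Set.univ (fun x : E => ‖x - x₀‖) := by
      have := (convexOn_univ_norm (E := E)).translate_left (-x₀)
      simpa [Function.comp_def, sub_eq_add_neg, add_comm] using this
    exact h1.pow (fun x _ => norm_nonneg _) 2

end SmoothConvex

end ConvexAnalysis

/-! ### Expectation and cost of composed programs -/

noncomputable section ProgramCalculus

namespace Prog

variable {d n : ℕ} {α β : Type} (F : Fin n → Vec d → ℝ)

@[simp] theorem expect_pure (φ : α → ℝ) (a : α) : expect F φ (pure a : Prog d n α) = φ a := rfl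

@[simp] theorem expect_bind (φ : β → ℝ) (P : Prog d n α) (Q : α → Prog d n β) :
    expect F φ (P >>= Q) = expect F (fun a => expect F φ (Q a)) P := by
  change expect F φ (P.bind Q) = _
  induction P with
  | ret a => rfl
  | call i x next ih => exact ih _
  | rand N p next ih => simp only [bind, expect, ih]

@[simp] theorem expect_ifo (φ : Vec d → ℝ) (i : Fin n) (x : Vec d) :
    expect F φ (ifo i x) = φ (gradient (F i) x) := rfl

@[simp] theorem expect_draw {N : ℕ} (φ : Fin N → ℝ) (p : PMF (Fin N)) :
    expect F φ (draw p : Prog d n (Fin N)) = ∑ j, (p j).toReal * φ j := rfl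

theorem expect_draw_uniform {N : ℕ} [NeZero N] (φ : Fin N → ℝ) :
    expect F φ (draw (PMF.uniformOfFintype (Fin N)) : Prog d n (Fin N)) =
      1 / (N : ℝ) * ∑ j, φ j := by
  simp [Finset.mul_sum]

theorem expect_mono {φ ψ : α → ℝ} (h : ∀ a, φ a ≤ ψ a) (P : Prog d n α) :
    expect F φ P ≤ expect F ψ P := by
  induction P with
  | ret a => exact h a
  | call i x next ih => exact ih _
  | rand N p next ih =>
    exact Finset.sum_le_sum fun j _ => mul_le_mul_of_nonneg_left (ih j) ENNReal.toReal_nonneg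

theorem sum_toReal_eq_one {N : ℕ} (p : PMF (Fin N)) : ∑ j, (p j).toReal = 1 := by
  rw [← ENNReal.toReal_sum (fun j _ => p.apply_ne_top j),
    ← tsum_fintype (L := .unconditional _), p.tsum_coe]
  rfl

theorem expect_affine (φ : α → ℝ) (k l : ℝ) (P : Prog d n α) :
    expect F (fun a => k * φ a + l) P = k * expect F φ P + l := by
  induction P with
  | ret a => rfl
  | call i x next ih => exact ih _
  | rand N p next ih =>
    simp only [expect, ih, mul_add, Finset.sum_add_distrib, ← Finset.sum_mul,
      sum_toReal_eq_one, one_mul, Finset.mul_sum]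
    congr 1
    exact Finset.sum_congr rfl fun j _ => by ring

@[simp] theorem ifoCalls_draw {N : ℕ} (p : PMF (Fin N)) :
    ifoCalls F (draw p : Prog d n (Fin N)) = 0 := by
  simp [draw, ifoCalls]

theorem ifoCalls_bind_le (P : Prog d n α) (Q : α → Prog d n β) {j k : ℕ}
    (hP : ifoCalls F P ≤ j) (hQ : ∀ a, ifoCalls F (Q a) ≤ k) :
    ifoCalls F (P >>= Q) ≤ j + k := by
  refine le_trans ?_ (Nat.add_le_add_right hP k)
  clear hP
  change ifoCalls F (P.bind Q) ≤ _
  induction P with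
  | ret a => exact (hQ a).trans (Nat.le_add_left _ _)
  | call i x next ih =>
    have := ih (gradient (F i) x)
    simp only [bind, ifoCalls]
    omega
  | rand N p next ih =>
    refine Finset.sup_le fun j _ => (ih j).trans (Nat.add_le_add_right ?_ k)
    exact Finset.le_sup (f := fun j => ifoCalls F (next j)) (Finset.mem_univ j)

end Prog

/-! ### Oracle calls of the algorithm -/

section Counting

variable {d n : ℕ} (F : Fin n → Vec d → ℝ)

theorem ifoCalls_sumGrad_le (x : Vec d) (l : List (Fin n)) :
    Prog.ifoCalls F (sumGrad x l) ≤ l.length := by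
  induction l with
  | nil => exact le_rfl
  | cons i is ih =>
    rw [List.length_cons, add_comm]
    exact Prog.ifoCalls_bind_le F _ _ le_rfl fun g =>
      Prog.ifoCalls_bind_le F (k := 0) _ _ ih fun r => le_rfl

theorem ifoCalls_fullGrad_le (x : Vec d) : Prog.ifoCalls F (fullGrad x) ≤ n :=
  Prog.ifoCalls_bind_le F (k := 0) _ _ (by simpa using ifoCalls_sumGrad_le F x (List.finRange n))
    fun _ => le_rfl

theorem ifoCalls_innerLoop_le [NeZero n] (η : ℝ) (r : ℕ) (xPrev x v : Vec d) :
    Prog.ifoCalls F (innerLoop η r xPrev x v) ≤ 2 * r := by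
  induction r generalizing xPrev x v with
  | zero => exact le_rfl
  | succ r ih =>
    have e : 2 * (r + 1) = 0 + (1 + (1 + (2 * r + 0))) := by ring
    rw [e]
    exact Prog.ifoCalls_bind_le F _ _ (Prog.ifoCalls_draw F _).le fun i =>
      Prog.ifoCalls_bind_le F _ _ le_rfl fun g =>
      Prog.ifoCalls_bind_le F _ _ le_rfl fun gPrev =>
      Prog.ifoCalls_bind_le F _ _ (ih _ _ _) fun _ => le_rfl

theorem ifoCalls_outerLoop_le [NeZero n] (lam : ℝ) (m : ℕ) (p : ℕ → PMF (Fin (m + 1))) (r s : ℕ)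
    (last : Option (Vec d × Vec d)) (η : ℝ) (x : Vec d) :
    Prog.ifoCalls F (outerLoop lam m p r s last η x) ≤ r * (n + 2 * (m - 1)) := by
  induction r generalizing s last η x with
  | zero => exact Nat.zero_le _
  | succ r ih =>
    have e : (r + 1) * (n + 2 * (m - 1)) =
      n + (2 * (m - 1) + (0 + r * (n + 2 * (m - 1)))) := by ring
    rw [e]
    exact Prog.ifoCalls_bind_le F _ _ (ifoCalls_fullGrad_le F x) fun v =>
      Prog.ifoCalls_bind_le F _ _ (ifoCalls_innerLoop_le F _ _ _ _ _) fun xs =>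
      Prog.ifoCalls_bind_le F _ _ (Prog.ifoCalls_draw F _).le fun k => ih _ _ _ _

end Counting

theorem expect_sumGrad {d n : ℕ} (F : Fin n → Vec d → ℝ) (φ : Vec d → ℝ) (x : Vec d)
    (l : List (Fin n)) :
    Prog.expect F φ (sumGrad x l) = φ (l.map fun i => gradient (F i) x).sum := by
  induction l generalizing φ with
  | nil => rfl
  | cons i is ih => simp [sumGrad, ih]

theorem expect_fullGrad {d n : ℕ} (F : Fin n → Vec d → ℝ) (φ : Vec d → ℝ) (x : Vec d) :
    Prog.expect F φ (fullGrad x) = φ ((1 / (n : ℝ)) • ∑ i, gradient (F i) x) := by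
  simp [fullGrad, expect_sumGrad, ← List.sum_ofFn, List.ofFn_eq_map]

end ProgramCalculus

/-! ### The SARAH potential and the inner loop -/

noncomputable section Sarah

/-- The gradient of `avg f`, as the average of the gradients of the components. -/
def avgGrad {d n : ℕ} (f : Fin n → Vec d → ℝ) (x : Vec d) : Vec d :=
  (1 / (n : ℝ)) • ∑ i, gradient (f i) x

theorem average_le {n : ℕ} [NeZero n] {a : Fin n → ℝ} {M : ℝ} (h : ∀ i, a i ≤ M) :
    1 / (n : ℝ) * ∑ i, a i ≤ M := by
  have hn : (0 : ℝ) < n := Nat.cast_pos.2 (NeZero.pos n)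
  have : ∑ i, a i ≤ n * M := by simpa using Finset.sum_le_sum fun i (_ : i ∈ Finset.univ) => h i
  rw [one_div, inv_mul_le_iff₀ hn]
  exact this

/-- Bias and variance: A is the mean of the D i, so the left side equals ‖w‖² plus the mean of ‖D
i‖² minus ‖A‖², and the last term is dropped. Here w is the previous estimation error. -/
theorem average_norm_sub_sq_le {E : Type*} [NormedAddCommGroup E] [InnerProductSpace ℝ E]
    {n : ℕ} [NeZero n] (D : Fin n → E) (w : E) :
    1 / (n : ℝ) * ∑ i, ‖(1 / (n : ℝ)) • ∑ j, D j + w - D i‖ ^ 2 ≤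
      ‖w‖ ^ 2 + 1 / (n : ℝ) * ∑ i, ‖D i‖ ^ 2 := by
  have hn : (n : ℝ) ≠ 0 := Nat.cast_ne_zero.2 (NeZero.ne n)
  set A := (1 / (n : ℝ)) • ∑ j, D j with hA
  have hs : ∑ j, D j = (n : ℝ) • A := by rw [hA, smul_smul, mul_one_div_cancel hn, one_smul]
  have h1 : ∑ i, ‖A + w - D i‖ ^ 2 =
      n * ‖A + w‖ ^ 2 - 2 * (n * inner ℝ (A + w) A) + ∑ i, ‖D i‖ ^ 2 := by
    simp only [norm_sub_sq_real (A + w), Finset.sum_add_distrib, Finset.sum_sub_distrib,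
      ← Finset.mul_sum, ← inner_sum, hs, inner_smul_right]
    simp
  have h2 : ‖A + w‖ ^ 2 - 2 * inner ℝ (A + w) A = ‖w‖ ^ 2 - ‖A‖ ^ 2 := by
    rw [norm_add_sq_real, inner_add_left, real_inner_self_eq_norm_sq, real_inner_comm]
    ring
  have h3 : 1 / (n : ℝ) * ∑ i, ‖A + w - D i‖ ^ 2 =
      (‖A + w‖ ^ 2 - 2 * inner ℝ (A + w) A) + 1 / (n : ℝ) * ∑ i, ‖D i‖ ^ 2 := by
    rw [h1]
    field_simp
  rw [h3, h2]
  linarith [sq_nonneg ‖A‖]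

section Average

variable {d n : ℕ} {f : Fin n → Vec d → ℝ} {K : ℝ}

theorem hasGradientAt_avg (hf : ∀ i, Differentiable ℝ (f i)) (x : Vec d) :
    HasGradientAt (avg f) (avgGrad f x) x := by
  rw [hasGradientAt_iff_hasFDerivAt]
  have h1 : HasFDerivAt (fun y => ∑ i, f i y) (∑ i, fderiv ℝ (f i) x) x :=
    HasFDerivAt.fun_sum fun i _ => (hf i x).hasFDerivAt
  refine (h1.const_mul (1 / (n : ℝ))).congr_fderiv ?_
  ext u
  simp [avgGrad]

theorem convexOn_avg (hc : ∀ i, ConvexOn ℝ Set.univ (f i)) : ConvexOn ℝ Set.univ (avg f) := by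
  refine ConvexOn.smul (c := 1 / (n : ℝ)) (by positivity) ⟨convex_univ, ?_⟩
  intro x _ y _ a b ha hb hab
  simp only [smul_eq_mul, Finset.mul_sum, ← Finset.sum_add_distrib]
  exact Finset.sum_le_sum fun i _ => (hc i).2 (Set.mem_univ x) (Set.mem_univ y) ha hb hab

theorem smoothConvex_avg [NeZero n] (hf : ∀ i, SmoothConvex (f i) (gradient (f i)) K) :
    SmoothConvex (avg f) (avgGrad f) K where
  hasGradientAt := hasGradientAt_avg fun i x => ((hf i).hasGradientAt x).differentiableAt
  convexOn := convexOn_avg fun i => (hf i).convexOn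
  lipschitz x y := by
    rw [avgGrad, avgGrad, ← smul_sub, ← Finset.sum_sub_distrib, norm_smul,
      Real.norm_of_nonneg (by positivity)]
    refine le_trans (mul_le_mul_of_nonneg_left (norm_sum_le _ _) (by positivity)) ?_
    exact average_le fun i => (hf i).lipschitz x y

end Average

variable {d n : ℕ} {f : Fin n → Vec d → ℝ} {K : ℝ}

/-- The recursive estimator contracts along the direction of the step. -/
theorem sarah_norm_sq_le (hf : ∀ i, SmoothConvex (f i) (gradient (f i)) K) (hK : 0 < K)
    {η q : ℝ} (hqη : q * (2 - η * K) = η * K) (hηK : η * K < 2)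
    {xPrev x v : Vec d} (hx : x = xPrev - η • v) (i : Fin n) :
    ‖gradient (f i) x - gradient (f i) xPrev‖ ^ 2 +
      q * ‖gradient (f i) x - gradient (f i) xPrev + v‖ ^ 2 ≤ q * ‖v‖ ^ 2 := by
  have hco := (hf i).cocoercive hK x xPrev
  have e : x - xPrev = -(η • v) := by rw [hx]; abel
  rw [e, inner_neg_left, real_inner_smul_left] at hco
  set D := gradient (f i) x - gradient (f i) xPrev
  rw [norm_add_sq_real, real_inner_comm]
  have h2 : (2 - η * K) * (q + 1) = 2 := by linarith
  have hpos : 0 < 2 - η * K := by linarith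
  -- Multiplied by 2 - ηK, the change in the potential is twice the slack in cocoercivity along the
  -- displacement -ηv; this dictates q.
  have h3 : (2 - η * K) * (‖D‖ ^ 2 + 2 * q * inner ℝ v D + q * ‖D‖ ^ 2) =
      2 * (‖D‖ ^ 2 + K * (η * inner ℝ v D)) := by
    linear_combination ‖D‖ ^ 2 * h2 + 2 * inner ℝ v D * hqη
  have h4 : ‖D‖ ^ 2 + 2 * q * inner ℝ v D + q * ‖D‖ ^ 2 ≤ 0 := by
    by_contra! h
    nlinarith [mul_pos hpos h]
  linarith

theorem average_sarah_potential_le [NeZero n]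
    (hf : ∀ i, SmoothConvex (f i) (gradient (f i)) K) (hK : 0 < K)
    {η q : ℝ} (hqη : q * (2 - η * K) = η * K) (hηK : η * K < 2)
    {xPrev x v : Vec d} (hx : x = xPrev - η • v) :
    1 / (n : ℝ) * ∑ i, (‖avgGrad f x - (gradient (f i) x - gradient (f i) xPrev + v)‖ ^ 2 +
      q * ‖gradient (f i) x - gradient (f i) xPrev + v‖ ^ 2) ≤
      ‖avgGrad f xPrev - v‖ ^ 2 + q * ‖v‖ ^ 2 := by
  have h1 := average_norm_sub_sq_le (fun i => gradient (f i) x - gradient (f i) xPrev)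
    (avgGrad f xPrev - v)
  have h2 := average_le fun i => sarah_norm_sq_le hf hK hqη hηK hx i
  have e : ∀ i, (1 / (n : ℝ)) • ∑ j, (gradient (f j) x - gradient (f j) xPrev) +
      (avgGrad f xPrev - v) - (gradient (f i) x - gradient (f i) xPrev) =
      avgGrad f x - (gradient (f i) x - gradient (f i) xPrev + v) := by
    intro i
    rw [Finset.sum_sub_distrib, smul_sub]
    simp only [avgGrad]
    abel
  simp only [e] at h1
  rw [Finset.sum_add_distrib, mul_add] at h2 ⊢
  linarith

/-- Telescoping of inexact descent steps, in which each estimation error is paid for by the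
nonincreasing potential. Any lower bound B of the objective will do, so no minimizer is needed.
Induction on the remaining iterations requires arbitrary `xPrev` and `v`. -/
theorem expect_innerLoop_le [NeZero n]
    (hf : ∀ i, SmoothConvex (f i) (gradient (f i)) K) (hK : 0 < K)
    {η q B : ℝ} (hη : 0 ≤ η) (hηK : η * K ≤ 1) (hq : 0 ≤ q) (hqη : q * (2 - η * K) = η * K)
    (hB : ∀ x, B ≤ avg f x) (z : Vec d) (r : ℕ) {xPrev x v : Vec d} (hx : x = xPrev - η • v) :
    Prog.expect f (fun ys => η / 2 * ∑ k : Fin (r + 1), ‖avgGrad f (ys.getD k z)‖ ^ 2)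
        (innerLoop η r xPrev x v) ≤
      avg f x - B + η / 2 * r * (‖avgGrad f xPrev - v‖ ^ 2 + q * ‖v‖ ^ 2) := by
  have hF := smoothConvex_avg hf
  induction r generalizing xPrev x v with
  | zero =>
    -- No step follows the last iterate; its gradient is paid for by the remaining gap to B, as ηK ≤
    -- 1.
    have h1 := hF.norm_sq_le hK hB x
    have h2 : 0 ≤ avg f x - B := sub_nonneg.2 (hB x)
    simp only [innerLoop, Prog.expect_pure]
    simp
    nlinarith [mul_le_mul_of_nonneg_left h1 hη, mul_le_mul_of_nonneg_right hηK h2]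
  | succ r ih =>
    have hstep : ∀ i : Fin n,
        η / 2 * ‖avgGrad f x‖ ^ 2 +
          Prog.expect f (fun ys => η / 2 * ∑ k : Fin (r + 1), ‖avgGrad f (ys.getD k z)‖ ^ 2)
            (innerLoop η r x (x - η • (gradient (f i) x - gradient (f i) xPrev + v))
              (gradient (f i) x - gradient (f i) xPrev + v)) ≤
        avg f x - B + η / 2 * (r + 1) *
          (‖avgGrad f x - (gradient (f i) x - gradient (f i) xPrev + v)‖ ^ 2 +
            q * ‖gradient (f i) x - gradient (f i) xPrev + v‖ ^ 2) := by
      intro i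
      set w := gradient (f i) x - gradient (f i) xPrev + v
      -- The step contributes one copy of the new error, the later iterations r copies of the
      -- potential; padding by q‖w‖² gives r + 1 copies of the potential.
      have h1 := ih (xPrev := x) (x := x - η • w) (v := w) rfl
      have h2 := hF.inexact_step hη hηK x w
      have h3 : 0 ≤ η / 2 * (q * ‖w‖ ^ 2) := by positivity
      linarith
    have hpot := average_sarah_potential_le hf hK hqη (by linarith) hx
    have hsum : ∀ (y : Vec d) (ys : List (Vec d)),
        η / 2 * ∑ k : Fin (r + 1 + 1), ‖avgGrad f ((y :: ys).getD k z)‖ ^ 2 =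
        1 * (η / 2 * ∑ k : Fin (r + 1), ‖avgGrad f (ys.getD k z)‖ ^ 2) +
          η / 2 * ‖avgGrad f y‖ ^ 2 := by
      intro y ys
      rw [Fin.sum_univ_succ]
      simp
      ring
    have hn : (n : ℝ) ≠ 0 := Nat.cast_ne_zero.2 (NeZero.ne n)
    simp only [innerLoop, Prog.expect_bind, Prog.expect_pure, Prog.expect_draw_uniform,
      Prog.expect_ifo, hsum, Prog.expect_affine]
    refine le_trans (b := 1 / (n : ℝ) * ∑ i, (avg f x - B + η / 2 * (r + 1) *
          (‖avgGrad f x - (gradient (f i) x - gradient (f i) xPrev + v)‖ ^ 2 +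
            q * ‖gradient (f i) x - gradient (f i) xPrev + v‖ ^ 2))) ?_ ?_
    · rw [one_mul]
      refine le_trans (le_of_eq ?_) (mul_le_mul_of_nonneg_left
        (Finset.sum_le_sum fun i (_ : i ∈ Finset.univ) => hstep i) (by positivity))
      rw [Finset.sum_add_distrib, Finset.sum_const, Finset.card_univ, Fintype.card_fin,
        nsmul_eq_mul]
      field_simp
      ring
    calc _ = avg f x - B + η / 2 * (r + 1) * (1 / (n : ℝ) *
          ∑ i, (‖avgGrad f x - (gradient (f i) x - gradient (f i) xPrev + v)‖ ^ 2 +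
            q * ‖gradient (f i) x - gradient (f i) xPrev + v‖ ^ 2)) := by
          rw [Finset.sum_add_distrib, ← Finset.mul_sum, Finset.sum_const, Finset.card_univ,
            Fintype.card_fin, nsmul_eq_mul]
          field_simp
      _ ≤ _ := by
          rw [Nat.cast_add, Nat.cast_one]
          gcongr

/-! ### Strong convexity, Barzilai–Borwein steps and contraction per epoch -/

/-- First-order form of `μ`-strong convexity of `avg f`. -/
def StrongAvg (f : Fin n → Vec d → ℝ) (μ : ℝ) : Prop :=
  ∀ x y, avg f x + inner ℝ (avgGrad f x) (y - x) + μ / 2 * ‖y - x‖ ^ 2 ≤ avg f y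

/-- Complete the square in y - x. This Polyak–Łojasiewicz bound supplies the lower bound B for the
inner loop. -/
theorem StrongAvg.sub_le {μ : ℝ} (h : StrongAvg f μ) (hμ : 0 < μ) (x y : Vec d) :
    avg f x - 1 / (2 * μ) * ‖avgGrad f x‖ ^ 2 ≤ avg f y := by
  have h1 := h x y
  have h2 : 0 ≤ μ / 2 * ‖(y - x) + μ⁻¹ • avgGrad f x‖ ^ 2 := by positivity
  rw [norm_add_sq_real, inner_smul_right, real_inner_comm, norm_smul, mul_pow, Real.norm_eq_abs,
    sq_abs] at h2
  have e : μ / 2 * (‖y - x‖ ^ 2 + 2 * (μ⁻¹ * inner ℝ (avgGrad f x) (y - x)) +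
      μ⁻¹ ^ 2 * ‖avgGrad f x‖ ^ 2) = μ / 2 * ‖y - x‖ ^ 2 + inner ℝ (avgGrad f x) (y - x) +
      1 / (2 * μ) * ‖avgGrad f x‖ ^ 2 := by
    field_simp
  rw [e] at h2
  linarith

theorem StrongAvg.monotone {μ : ℝ} (h : StrongAvg f μ) (x y : Vec d) :
    μ * ‖x - y‖ ^ 2 ≤ inner ℝ (x - y) (avgGrad f x - avgGrad f y) := by
  have h1 := h x y
  have h2 := h y x
  rw [norm_sub_rev] at h1
  rw [real_inner_comm]
  simp only [inner_sub_left, inner_sub_right] at *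
  linarith

/-- The Barzilai-Borwein steps stay in the range prescribed for the initial step. -/
theorem bbStep_mem [NeZero n] {μ lam η : ℝ} (hf : ∀ i, SmoothConvex (f i) (gradient (f i)) K)
    (hμ : 0 < μ) (hstr : StrongAvg f μ) (hlam : 0 < lam)
    {last : Option (Vec d × Vec d)} (hlast : ∀ p ∈ last, p.2 = avgGrad f p.1)
    (hη : η ∈ Set.Icc (1 / (lam * K)) (1 / (lam * μ))) (x : Vec d) :
    bbStep lam last η x (avgGrad f x) ∈ Set.Icc (1 / (lam * K)) (1 / (lam * μ)) := by
  rcases last with _ | ⟨y, g⟩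
  · exact hη
  · obtain rfl : g = avgGrad f y := hlast (y, g) rfl
    simp only [bbStep]
    split_ifs with hxy
    · exact hη
    -- The inner product lies between μ and K times ‖x - y‖²; in particular the quotient has a
    -- positive denominator.
    · have hN : 0 < ‖x - y‖ := norm_pos_iff.2 (sub_ne_zero.2 hxy)
      have hlo := hstr.monotone x y
      have hhi : inner ℝ (x - y) (avgGrad f x - avgGrad f y) ≤ K * ‖x - y‖ ^ 2 := by
        refine (real_inner_le_norm _ _).trans ?_
        nlinarith [(smoothConvex_avg hf).lipschitz x y]
      have hI : 0 < inner ℝ (x - y) (avgGrad f x - avgGrad f y) :=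
        lt_of_lt_of_le (by positivity) hlo
      have hK : 0 < K := by
        by_contra! hK
        nlinarith [sq_nonneg ‖x - y‖]
      constructor
      · rw [one_div_mul_eq_div, div_div, div_le_div_iff₀ (by positivity) (by positivity)]
        nlinarith
      · rw [one_div_mul_eq_div, div_div, div_le_div_iff₀ (by positivity) (by positivity)]
        nlinarith

/-- Here r = m - 1, so the r + 2 averaged points are x_0, …, x_m. The factor 1/2 is 1/6 from the
initial gap plus 1/3 from the estimation error. -/
theorem expect_epoch_le [NeZero n] {μ lam η : ℝ}
    (hf : ∀ i, SmoothConvex (f i) (gradient (f i)) K)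
    (hK : 0 < K) (hμ : 0 < μ) (hstr : StrongAvg f μ) (hlam : 2 * K ≤ lam * μ) {r : ℕ}
    (hr : 6 * (lam * K) ≤ μ * (r + 2))
    (hη : η ∈ Set.Icc (1 / (lam * K)) (1 / (lam * μ))) (x : Vec d) :
    Prog.expect f (fun ys => 1 / ((r + 2 : ℕ) : ℝ) *
        ∑ k : Fin (r + 2), ‖avgGrad f ((x :: ys).getD k x)‖ ^ 2)
      (innerLoop η r x (x - η • avgGrad f x) (avgGrad f x)) ≤ 1 / 2 * ‖avgGrad f x‖ ^ 2 := by
  have hlam' : 0 < lam := pos_of_mul_pos_left (by linarith) hμ.le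
  have hη0 : 0 < η := lt_of_lt_of_le (by positivity) hη.1
  have hηK : η * K ≤ 1 / 2 := by
    calc η * K ≤ 1 / (lam * μ) * K := by gcongr; exact hη.2
      _ = K / (lam * μ) := by ring
      _ ≤ 1 / 2 := by rw [div_le_div_iff₀ (by positivity) two_pos]; linarith
  have hημ : 6 ≤ μ * η * (r + 2) := by
    have h1 := hη.1
    rw [div_le_iff₀ (by positivity)] at h1
    nlinarith
  set q := η * K / (2 - η * K) with hqdef
  have hpos : 0 < 2 - η * K := by linarith
  have hq : 0 ≤ q := by positivity
  have hqη : q * (2 - η * K) = η * K := div_mul_cancel₀ _ hpos.ne'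
  have hq3 : q ≤ 1 / 3 := by rw [hqdef, div_le_div_iff₀ hpos three_pos]; linarith
  -- The initial estimate is exact: the potential starts at q‖∇F(x)‖², and the first step descends
  -- by η/2 ‖∇F(x)‖², which accounts for x_0 in the average.
  have hin := expect_innerLoop_le hf hK hη0.le (by linarith) hq hqη (hstr.sub_le hμ x) x r
    (xPrev := x) (v := avgGrad f x) rfl
  have hst := (smoothConvex_avg hf).inexact_step hη0.le (by linarith) x (avgGrad f x)
  have hsum : ∀ ys : List (Vec d), 1 / ((r + 2 : ℕ) : ℝ) *
      ∑ k : Fin (r + 2), ‖avgGrad f ((x :: ys).getD k x)‖ ^ 2 =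
      2 / (η * (r + 2)) * (η / 2 * ∑ k : Fin (r + 1), ‖avgGrad f (ys.getD k x)‖ ^ 2) +
        1 / (r + 2) * ‖avgGrad f x‖ ^ 2 := by
    intro ys
    rw [Fin.sum_univ_succ]
    simp
    field_simp
    ring
  simp only [hsum, Prog.expect_affine]
  set X := Prog.expect f (fun ys => η / 2 * ∑ k : Fin (r + 1), ‖avgGrad f (ys.getD k x)‖ ^ 2)
    (innerLoop η r x (x - η • avgGrad f x) (avgGrad f x))
  set N := ‖avgGrad f x‖ ^ 2 with hN
  have hN0 : 0 ≤ N := by positivity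
  simp only [sub_self, norm_zero] at hin hst
  have hX : X + η / 2 * N ≤ 1 / (2 * μ) * N + η / 2 * r * (1 / 3 * N) := by
    have : η / 2 * r * (q * N) ≤ η / 2 * r * (1 / 3 * N) := by gcongr
    linarith
  have hmu : 1 / (2 * μ) ≤ η * (r + 2) / 12 := by
    rw [div_le_div_iff₀ (by positivity) (by norm_num)]
    linarith
  have hX2 : X + η / 2 * N ≤ η * (r + 2) / 4 * N := by
    have := mul_le_mul_of_nonneg_right hmu hN0
    have h3 : 0 ≤ η * N := by positivity
    linarith
  calc 2 / (η * (r + 2)) * X + 1 / (r + 2) * N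
      = 2 / (η * (r + 2)) * (X + η / 2 * N) := by field_simp
    _ ≤ 2 / (η * (r + 2)) * (η * (r + 2) / 4 * N) := by gcongr
    _ = 1 / 2 * N := by field_simp; ring

theorem expect_outerLoop_le [NeZero n] {μ lam : ℝ}
    (hf : ∀ i, SmoothConvex (f i) (gradient (f i)) K)
    (hK : 0 < K) (hμ : 0 < μ) (hstr : StrongAvg f μ) (hlam : 2 * K ≤ lam * μ) {m : ℕ}
    (hm0 : 0 < m) (hm : 6 * (lam * K) ≤ μ * (m + 1)) (r s : ℕ) {η : ℝ}
    {last : Option (Vec d × Vec d)} (hlast : ∀ p ∈ last, p.2 = avgGrad f p.1)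
    (hη : η ∈ Set.Icc (1 / (lam * K)) (1 / (lam * μ))) (x : Vec d) :
    Prog.expect f (fun y => ‖avgGrad f y‖ ^ 2)
      (outerLoop lam m (fun _ => PMF.uniformOfFintype (Fin (m + 1))) r s last η x) ≤
      (1 / 2) ^ r * ‖avgGrad f x‖ ^ 2 := by
  have hlam' : 0 < lam := pos_of_mul_pos_left (by linarith) hμ.le
  obtain ⟨l, rfl⟩ : ∃ l, m = l + 1 := ⟨m - 1, by omega⟩
  induction r generalizing s η last x with
  | zero => simp [outerLoop]
  | succ r ih =>
    have hη' := bbStep_mem hf hμ hstr hlam' hlast hη x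
    simp only [outerLoop, Prog.expect_bind, expect_fullGrad, Prog.expect_draw_uniform]
    change Prog.expect f _ (innerLoop (bbStep lam last η x (avgGrad f x)) (l + 1 - 1) x
      (x - bbStep lam last η x (avgGrad f x) • avgGrad f x) (avgGrad f x)) ≤ _
    set η' := bbStep lam last η x (avgGrad f x)
    have hep := expect_epoch_le hf hK hμ hstr hlam (r := l) (by push_cast at hm; linarith) hη' x
    -- Apply the induction hypothesis from each possible next snapshot; the dummy `+ 0` puts the
    -- bound in the shape of `Prog.expect_affine`.
    refine (Prog.expect_mono f (ψ := fun ys => (1 / 2) ^ r * (1 / ((l + 2 : ℕ) : ℝ) *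
        ∑ k : Fin (l + 2), ‖avgGrad f ((x :: ys).getD k x)‖ ^ 2) + 0) (fun ys => ?_) _).trans ?_
    · rw [add_zero, mul_left_comm, Finset.mul_sum _ _ ((1 / 2 : ℝ) ^ r)]
      gcongr with k
      exact ih _ (fun p hp => by cases hp; rfl) hη' _
    · rw [Prog.expect_affine, add_zero, pow_succ, mul_assoc]
      exact mul_le_mul_of_nonneg_left hep (by positivity)

end Sarah

/-! ### From the regularized objective back to the original one -/

section Regularization

variable {d n : ℕ} {f : Fin n → Vec d → ℝ} {L μ : ℝ}

theorem gradient_regularize (hf : ∀ i, SmoothConvex (f i) (gradient (f i)) L) (hμ : 0 ≤ μ)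
    (x₀ : Vec d) (i : Fin n) :
    gradient (regularize f μ x₀ i) = fun x => gradient (f i) x + μ • (x - x₀) :=
  gradient_eq ((hf i).regularize hμ x₀).hasGradientAt

theorem smoothConvex_regularize (hf : ∀ i, SmoothConvex (f i) (gradient (f i)) L) (hμ : 0 ≤ μ)
    (x₀ : Vec d) (i : Fin n) :
    SmoothConvex (regularize f μ x₀ i) (gradient (regularize f μ x₀ i)) (L + μ) := by
  rw [gradient_regularize hf hμ]
  exact (hf i).regularize hμ x₀

theorem avgGrad_regularize [NeZero n]
    (hf : ∀ i, SmoothConvex (f i) (gradient (f i)) L) (hμ : 0 ≤ μ)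
    (x₀ x : Vec d) :
    avgGrad (regularize f μ x₀) x = avgGrad f x + μ • (x - x₀) := by
  have hn : (n : ℝ) ≠ 0 := Nat.cast_ne_zero.2 (NeZero.ne n)
  simp only [avgGrad, gradient_regularize hf hμ, Finset.sum_add_distrib, smul_add]
  rw [Finset.sum_const, Finset.card_univ, Fintype.card_fin, ← Nat.cast_smul_eq_nsmul ℝ,
    smul_smul (1 / (n : ℝ)), one_div_mul_cancel hn, one_smul]

theorem avg_regularize [NeZero n] (x₀ x : Vec d) :
    avg (regularize f μ x₀) x = avg f x + μ / 2 * ‖x - x₀‖ ^ 2 := by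
  have hn : (n : ℝ) ≠ 0 := Nat.cast_ne_zero.2 (NeZero.ne n)
  simp only [avg, regularize, Finset.sum_add_distrib, mul_add]
  rw [Finset.sum_const, Finset.card_univ, Fintype.card_fin, nsmul_eq_mul, ← mul_assoc,
    one_div_mul_cancel hn, one_mul]

theorem strongAvg_regularize [NeZero n]
    (hf : ∀ i, SmoothConvex (f i) (gradient (f i)) L) (hμ : 0 ≤ μ)
    (x₀ : Vec d) : StrongAvg (regularize f μ x₀) μ := by
  intro x y
  have h1 := (smoothConvex_avg hf).add_inner_le x y
  rw [avg_regularize, avg_regularize, avgGrad_regularize hf hμ, inner_add_left,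
    real_inner_smul_left]
  have e : ‖y - x₀‖ ^ 2 = ‖x - x₀‖ ^ 2 + 2 * inner ℝ (x - x₀) (y - x) + ‖y - x‖ ^ 2 := by
    rw [← norm_add_sq_real]
    congr 2
    abel
  rw [e]
  linarith

theorem avgGrad_eq_zero_of_forall_le (hf : ∀ i, Differentiable ℝ (f i)) {xs : Vec d}
    (hmin : ∀ x, avg f xs ≤ avg f x) : avgGrad f xs = 0 := by
  have h := (hasGradientAt_avg hf xs).hasFDerivAt
  have h0 := (IsLocalMin.hasFDerivAt_eq_zero (Filter.Eventually.of_forall hmin) h)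
  simpa using h0

/-- An approximate stationary point of the regularized objective is one of the objective. -/
theorem norm_avgGrad_sq_le [NeZero n] (hf : ∀ i, SmoothConvex (f i) (gradient (f i)) L) (hμ : 0 < μ)
    (x₀ : Vec d) {xs : Vec d} (hxs : avgGrad f xs = 0) (x : Vec d) :
    ‖avgGrad f x‖ ^ 2 ≤
      8 * ‖avgGrad (regularize f μ x₀) x‖ ^ 2 + 8 * (μ * ‖x₀ - xs‖) ^ 2 := by
  set g := avgGrad (regularize f μ x₀) x with hg
  have hgx := avgGrad_regularize hf hμ.le x₀ x
  have hgs : avgGrad (regularize f μ x₀) xs = μ • (xs - x₀) := by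
    rw [avgGrad_regularize hf hμ.le, hxs, zero_add]
  have hmon := (strongAvg_regularize hf hμ.le x₀).monotone x xs
  have hns : ‖μ • (xs - x₀)‖ = μ * ‖x₀ - xs‖ := by
    rw [norm_smul, Real.norm_of_nonneg hμ.le, norm_sub_rev]
  -- The comparison is with the minimizer of f, where the regularized gradient is just μ(xs - x₀);
  -- strong monotonicity then controls the distance, and the minimizer of the surrogate never
  -- enters.
  have h1 : μ * ‖x - xs‖ ≤ ‖g‖ + μ * ‖x₀ - xs‖ := by
    rw [hgs] at hmon
    have h2 : inner ℝ (x - xs) (g - μ • (xs - x₀)) ≤ ‖x - xs‖ * (‖g‖ + μ * ‖x₀ - xs‖) := by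
      refine (real_inner_le_norm _ _).trans ?_
      gcongr
      exact (norm_sub_le _ _).trans (by rw [hns])
    rcases (norm_nonneg (x - xs)).eq_or_lt with h0 | h0
    · rw [← h0, mul_zero]
      positivity
    · refine le_of_mul_le_mul_left ?_ h0
      linarith
  have h3 : ‖avgGrad f x‖ ≤ 2 * ‖g‖ + 2 * (μ * ‖x₀ - xs‖) := by
    have e : avgGrad f x = g - μ • ((x - xs) + (xs - x₀)) := by
      rw [hg, hgx]
      module
    have h4 : ‖μ • ((x - xs) + (xs - x₀))‖ ≤ μ * ‖x - xs‖ + μ * ‖x₀ - xs‖ := by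
      rw [smul_add]
      refine (norm_add_le _ _).trans ?_
      rw [hns, norm_smul, Real.norm_of_nonneg hμ.le]
    rw [e]
    linarith [norm_sub_le g (μ • ((x - xs) + (xs - x₀)))]
  have h5 : ‖avgGrad f x‖ ^ 2 ≤ (2 * ‖g‖ + 2 * (μ * ‖x₀ - xs‖)) ^ 2 := by gcongr
  nlinarith [sq_nonneg (‖g‖ - μ * ‖x₀ - xs‖)]

end Regularization

/-! ### Choice of parameters and the final bounds -/

theorem half_pow_mul_le {R ε s : ℝ} {S : ℕ} (hε : 0 < ε) (hR : 0 ≤ R) (hs : 8 ≤ s)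
    (hS : s * max 1 (Real.log (R / ε)) ≤ S) : (1 / 2) ^ S * R ≤ ε / 16 := by
  set l := max 1 (Real.log (R / ε)) with hl
  have hl1 : 1 ≤ l := le_max_left _ _
  have h1 : R ≤ ε * Real.exp l := by
    rcases hR.eq_or_lt with h0 | h0
    · rw [← h0]; positivity
    · rw [← div_le_iff₀' hε, ← Real.exp_log (div_pos h0 hε)]
      exact Real.exp_le_exp.2 (le_max_right _ _)
  have hlog := Real.log_two_gt_d9
  have h16 : (1 / 16 : ℝ) = Real.exp (-(4 * Real.log 2)) := by
    rw [Real.exp_neg, mul_comm, Real.exp_mul, Real.exp_log two_pos]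
    norm_num
  have hpow : (1 / 2 : ℝ) ^ S = Real.exp (-(S * Real.log 2)) := by
    rw [Real.exp_neg, mul_comm, Real.exp_mul, Real.exp_log two_pos, Real.rpow_natCast, one_div,
      inv_pow]
  calc (1 / 2) ^ S * R ≤ Real.exp (-(S * Real.log 2)) * (ε * Real.exp l) := by
        rw [hpow]; gcongr
    _ = ε * Real.exp (l - S * Real.log 2) := by
        rw [sub_eq_add_neg, Real.exp_add]; ring
    _ ≤ ε * Real.exp (-(4 * Real.log 2)) := by
        gcongr
        -- As l ≥ 1 and 4 log 2 > 1, 8l epochs pay for both e^l and the factor 1/16.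
        have h8 : 8 * l ≤ S := le_trans (by gcongr) hS
        have h9 : 8 * l * Real.log 2 ≤ S * Real.log 2 := by gcongr
        nlinarith
    _ = ε / 16 := by rw [← h16]; ring

/-- With t = LD/(c√ε), the quotient is 1 + t, and (1 + t)² ≤ 2 + 2t². -/
theorem condition_number_sq_le {L c ε D : ℝ} (hc : 0 < c) (hε : 0 < ε) (hD : 0 < D) :
    ((L + c * (√ε / D)) / (c * (√ε / D))) ^ 2 ≤ 2 + 2 / c ^ 2 * (L ^ 2 * D ^ 2 / ε) := by
  have hsq : √ε ^ 2 = ε := Real.sq_sqrt hε.le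
  have hε' : 0 < √ε := Real.sqrt_pos.2 hε
  have e : (L + c * (√ε / D)) / (c * (√ε / D)) = 1 + L * D / (c * √ε) := by
    field_simp
    ring
  have e2 : (L * D / (c * √ε)) ^ 2 = 1 / c ^ 2 * (L ^ 2 * D ^ 2 / ε) := by
    rw [div_pow, mul_pow c, hsq]
    field_simp
  have h := sq_nonneg (1 - L * D / (c * √ε))
  have e3 : 2 / c ^ 2 * (L ^ 2 * D ^ 2 / ε) = 2 * (1 / c ^ 2 * (L ^ 2 * D ^ 2 / ε)) := by ring
  rw [e, e3, ← e2]
  nlinarith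

theorem corollary1 :
    ∃ c₀ : ℝ, 0 < c₀ ∧ ∃ a₀ : ℝ, 0 < a₀ ∧
    ∀ c : ℝ, 0 < c → c ≤ c₀ → ∀ a : ℝ, a₀ ≤ a →
    ∃ b₀ : ℝ, 0 < b₀ ∧ ∀ b : ℝ, b₀ ≤ b →
    ∃ s₀ : ℝ, 0 < s₀ ∧ ∀ s : ℝ, s₀ ≤ s →
    ∃ C : ℝ, 0 < C ∧
    ∀ (d n : ℕ) [NeZero n] (f : Fin n → Vec d → ℝ) (L : ℝ) (x₀ xs : Vec d) (ε : ℝ),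
      0 ≤ L →
      (∀ i, Differentiable ℝ (f i)) →
      (∀ i x y, ‖gradient (f i) x - gradient (f i) y‖ ≤ L * ‖x - y‖) →
      (∀ i, ConvexOn ℝ Set.univ (f i)) →
      (∀ x, avg f xs ≤ avg f x) →
      x₀ ≠ xs →
      0 < ε →
      ∀ (μ κ lam η : ℝ) (m S : ℕ),
        μ = c * (√ε / ‖x₀ - xs‖) →
        κ = (L + μ) / μ →
        lam = a * κ →
        1 / (lam * (L + μ)) ≤ η → η ≤ 1 / (lam * μ) →
        m = ⌈b * κ ^ 2⌉₊ →
        S = ⌈s * max 1 (Real.log (‖gradient (avg f) x₀‖ ^ 2 / ε))⌉₊ →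
        Prog.expect (regularize f μ x₀) (fun x => ‖gradient (avg f) x‖ ^ 2)
            (bbSarah x₀ η lam m S fun _ => PMF.uniformOfFintype (Fin (m + 1))) ≤ ε ∧
        ((Prog.ifoCalls (regularize f μ x₀)
            (bbSarah x₀ η lam m S fun _ => PMF.uniformOfFintype (Fin (m + 1))) : ℕ) : ℝ) ≤
          C * ((n + L ^ 2 * ‖x₀ - xs‖ ^ 2 / ε) *
            max 1 (Real.log (‖gradient (avg f) x₀‖ ^ 2 / ε))) := by
  -- c ≤ 1/4 leaves bias at most ε/2; a ≥ 2 gives ηK ≤ 1/2; b ≥ 6a gives μη(m+1) ≥ 6; σ ≥ 8 brings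
  -- the regularized squared gradient norm to ε/16. In C, s + 1 covers the number of epochs and the
  -- other factor the cost of one.
  refine ⟨1 / 4, by norm_num, 2, two_pos, fun c hc hc₀ a ha => ⟨6 * a, by linarith,
    fun b hb => ⟨8, by norm_num, fun s hs => ⟨(s + 1) * (1 + 4 * b + 4 * b / c ^ 2), ?_, ?_⟩⟩⟩⟩
  · have : 0 < b := by linarith
    positivity
  intro d n _ f L x₀ xs ε hL hdiff hlip hconv hmin hne hε μ κ lam η m S hμ hκ hlam hη₁ hη₂ hm hS
  have ha0 : 0 < a := by linarith
  have hb0 : 0 < b := by linarith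
  have hD : 0 < ‖x₀ - xs‖ := norm_pos_iff.2 (sub_ne_zero.2 hne)
  have hε' : 0 < √ε := Real.sqrt_pos.2 hε
  have hμ0 : 0 < μ := by rw [hμ]; positivity
  have hK : 0 < L + μ := by linarith
  have hκ1 : 1 ≤ κ := by rw [hκ, le_div_iff₀ hμ0]; linarith
  have hκμ : κ * μ = L + μ := by rw [hκ, div_mul_cancel₀ _ hμ0.ne']
  have hf : ∀ i, SmoothConvex (f i) (gradient (f i)) L := fun i =>
    ⟨fun x => (hdiff i x).hasGradientAt, hlip i, hconv i⟩
  have hgrad : gradient (avg f) = avgGrad f := gradient_eq (hasGradientAt_avg hdiff)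
  have hmb : b * κ ^ 2 ≤ m := hm ▸ Nat.le_ceil _
  have hm0 : 0 < m := by rw [hm, Nat.ceil_pos]; positivity
  rw [hgrad] at hS ⊢
  set l := max 1 (Real.log (‖avgGrad f x₀‖ ^ 2 / ε)) with hl
  have hl1 : 1 ≤ l := le_max_left _ _
  constructor
  · have hlamK : 2 * (L + μ) ≤ lam * μ := by
      rw [hlam, mul_assoc, hκμ]
      gcongr
    have hmK : 6 * (lam * (L + μ)) ≤ μ * (m + 1) := by
      calc 6 * (lam * (L + μ)) = μ * (6 * a * κ ^ 2) := by rw [hlam, ← hκμ]; ring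
        _ ≤ μ * (b * κ ^ 2) := by gcongr
        _ ≤ μ * (m + 1) := by gcongr; linarith
    have hmain := expect_outerLoop_le (smoothConvex_regularize hf hμ0.le x₀) hK hμ0
      (strongAvg_regularize hf hμ0.le x₀) hlamK hm0 hmK S 1 (last := none) (by simp)
      ⟨hη₁, hη₂⟩ x₀
    -- The penalty has zero gradient at its center x₀, so the starting value is ‖∇f(x₀)‖², the one
    -- in the logarithm.
    rw [avgGrad_regularize hf hμ0.le x₀ x₀, sub_self, smul_zero, add_zero] at hmain
    have hdecay := half_pow_mul_le hε (sq_nonneg ‖avgGrad f x₀‖) hs (hS ▸ Nat.le_ceil _)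
    have hbias : (μ * ‖x₀ - xs‖) ^ 2 ≤ ε / 16 := by
      have e : μ * ‖x₀ - xs‖ = c * √ε := by rw [hμ]; field_simp
      rw [e, mul_pow, Real.sq_sqrt hε.le]
      have : c ^ 2 ≤ (1 / 4) ^ 2 := by gcongr
      nlinarith
    refine (Prog.expect_mono _ (norm_avgGrad_sq_le hf hμ0 x₀
      (avgGrad_eq_zero_of_forall_le hdiff hmin)) _).trans ?_
    rw [Prog.expect_affine]
    unfold bbSarah
    linarith
  · have hcalls := ifoCalls_outerLoop_le (regularize f μ x₀) lam m
      (fun _ => PMF.uniformOfFintype (Fin (m + 1))) S 1 none η x₀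
    have hS1 : (S : ℝ) ≤ (s + 1) * l := by
      have := Nat.ceil_lt_add_one (show 0 ≤ s * l by positivity)
      rw [← hS] at this
      linarith
    -- Only m - 1 inner iterations query the oracle, which absorbs the rounding in m.
    have hm1 : ((m - 1 : ℕ) : ℝ) ≤ b * κ ^ 2 := by
      have := Nat.ceil_lt_add_one (show 0 ≤ b * κ ^ 2 by positivity)
      rw [← hm] at this
      rw [Nat.cast_pred hm0]
      linarith
    have hn1 : (1 : ℝ) ≤ n := Nat.one_le_cast.2 (NeZero.pos n)
    have hκ2 : κ ^ 2 ≤ 2 + 2 / c ^ 2 * (L ^ 2 * ‖x₀ - xs‖ ^ 2 / ε) := by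
      rw [hκ, hμ]
      exact condition_number_sq_le hc hε hD
    set X := L ^ 2 * ‖x₀ - xs‖ ^ 2 / ε with hX
    have hX0 : 0 ≤ X := by positivity
    have hper : (n : ℝ) + 2 * ((m - 1 : ℕ) : ℝ) ≤ (1 + 4 * b + 4 * b / c ^ 2) * (n + X) := by
      have h1 : b * κ ^ 2 ≤ b * (2 + 2 / c ^ 2 * X) := by gcongr
      have h2 : 0 ≤ 4 * b / c ^ 2 * n := by positivity
      -- The constant part of the bound on κ² is absorbed by n ≥ 1.
      have h3 : 4 * b * 1 ≤ 4 * b * n := by gcongr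
      have h4 : 0 ≤ (1 + 4 * b) * X := by positivity
      have e : b * (2 + 2 / c ^ 2 * X) = 2 * b + (4 * b / c ^ 2 * X) / 2 := by ring
      linarith
    calc _ ≤ ((S * (n + 2 * (m - 1)) : ℕ) : ℝ) := Nat.cast_le.2 hcalls
      _ = S * (n + 2 * ((m - 1 : ℕ) : ℝ)) := by push_cast; ring
      _ ≤ (s + 1) * l * ((1 + 4 * b + 4 * b / c ^ 2) * (n + X)) := by gcongr
      _ = _ := by ring
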